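/- Let $\zeta=(\zeta(s))_{s\ge 0}$ be a standard Brownian motion in $\mathbb{R}^2$ and let $r>0$. For a deterministic continuous function $g:[0,\infty)\to\mathbb{R}^2$ and $t\ge 0$ let $$W_g(t)=\bigcup_{0\le s\le t} B\bigl(g(s)-\zeta(s),r\bigr)$$ be the Wiener sausage with drift $g$ up to time $t$, where $B(x,r)$ is the closed ball of radius $r$ centred at $x$ and $\operatorname{vol}$ denotes Lebesgue measure on $\mathbb{R}^2$. Then, as $t\to\infty$, $$\mathbb{E}\bigl[\operatorname{vol}(W_g(t))\bigr]\ \ge\ \frac{2\pi t}{\log t}\,(1-o(1)),$$ uniformly in $g$; that is, there is a function $\varepsilon$ with $\varepsilon(t)\to 0$ as $t\to\infty$, not depending on $g$, such that $\mathbb{E}[\operatorname{vol}(W_g(t))]\ge \frac{2\pi t}{\log t}(1-\varepsilon(t))$ for every continuous $g:[0,\infty)\to\mathbb{R}^2$ and every $t>1$. -/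

import Mathlib

open MeasureTheory ProbabilityTheory Filter Topology
open scoped NNReal ENNReal

/-- `ζ` is a standard Brownian motion in `ℝᵈ` under `P`: its coordinate processes are standard
one-dimensional Brownian motions (started at `0`, with almost surely continuous paths) and they are
independent of one another as processes. -/
structure IsStandardBrownianMotion {Ω : Type*} [MeasurableSpace Ω] {d : ℕ}
    (ζ : ℝ≥0 → Ω → EuclideanSpace ℝ (Fin d)) (P : Measure Ω) : Prop where
  coord : ∀ i : Fin d, IsBrownianReal (fun (s : ℝ≥0) (ω : Ω) => ζ s ω i) P
  indep : iIndepFun (fun (i : Fin d) (ω : Ω) (s : ℝ≥0) => ζ s ω i) P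

/-- The Wiener sausage with drift `g` of radius `r` up to time `t`, on the sample `ω`:
the union of the balls `B(g(s) - ζ(s), r)` over `0 ≤ s ≤ t`. -/
def wienerSausage {Ω : Type*} {d : ℕ} (ζ : ℝ≥0 → Ω → EuclideanSpace ℝ (Fin d))
    (g : ℝ≥0 → EuclideanSpace ℝ (Fin d)) (r : ℝ) (t : ℝ≥0) (ω : Ω) :
    Set (EuclideanSpace ℝ (Fin d)) :=
  ⋃ s ∈ Set.Icc (0 : ℝ≥0) t, Metric.closedBall (g s - ζ s ω) r

/-- The expected Lebesgue measure `E[vol W_g(t)]` of the Wiener sausage with drift, as an element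
of `[0, ∞]`. -/
noncomputable def expectedSausageVolume {Ω : Type*} [MeasurableSpace Ω] {d : ℕ} (P : Measure Ω)
    (ζ : ℝ≥0 → Ω → EuclideanSpace ℝ (Fin d)) (g : ℝ≥0 → EuclideanSpace ℝ (Fin d)) (r : ℝ)
    (t : ℝ≥0) : ℝ≥0∞ :=
  ∫⁻ ω, volume (wienerSausage ζ g r t ω) ∂P

/-! Only integer times matter: the sausage contains the balls around `g k - ζ k` for `k ≤ ⌊t⌋`. Fix
`x` and let `A k` be the event that ball `k` covers `x`. Split `A k` by the first index `j` whose
ball covers `x`. Given the past up to `j`, covering again at `k > j` forces a planar Gaussian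
increment of variance `m = k - j` per coordinate into a disc of radius `r`. Wherever the drift puts
that disc, the probability is at most density maximum times area, `r² / (2m)`. Hence `∑ P (A k) ≤ (1
+ ∑ r² / (2m)) * P (⋃ A k)`.

Integrating over `x` turns the left side into (number of times) `* π r²` and the right side into a
harmonic sum, about `(r² / 2) log t`, times the expected volume. The factor `r²` cancels to leading
order, giving `2π t / log t` uniformly in `g`. -/

/-! ### First-entrance decomposition -/

/-- `disjointed A j` is the event that `j` is the first index to occur; `c m` bounds the chance of a
recurrence `m` steps later. -/
theorem sum_measure_le_of_measure_inter_disjointed_le {Ω : Type*} [MeasurableSpace Ω]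
    (P : Measure Ω) (A : ℕ → Set Ω) (hA : ∀ k, MeasurableSet (A k)) (c : ℕ → ℝ≥0∞)
    (h : ∀ j k, j ≤ k → P (A k ∩ disjointed A j) ≤ c (k - j) * P (disjointed A j)) (n : ℕ) :
    ∑ k ∈ Finset.range n, P (A k)
      ≤ (∑ m ∈ Finset.range n, c m) * P (⋃ k ∈ Finset.range n, A k) := by
  have hD : ∀ j, MeasurableSet (disjointed A j) := fun j => MeasurableSet.disjointed hA j
  have h1 : ∀ k, P (A k) ≤ ∑ j ∈ Finset.range (k + 1), c (k - j) * P (disjointed A j) := by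
    intro k
    have hsub : A k ⊆ ⋃ j ∈ Finset.range (k + 1), (A k ∩ disjointed A j) := by
      rw [← Set.inter_iUnion₂, biUnion_range_succ_disjointed]
      exact Set.subset_inter le_rfl (le_partialSups A k)
    calc P (A k) ≤ _ := measure_mono hsub
      _ ≤ ∑ j ∈ Finset.range (k + 1), P (A k ∩ disjointed A j) := measure_biUnion_finset_le _ _
      _ ≤ _ := Finset.sum_le_sum fun j hj => h j k (by simpa [Nat.lt_succ_iff] using hj)
  have h2 : ∑ j ∈ Finset.range n, P (disjointed A j) ≤ P (⋃ k ∈ Finset.range n, A k) := by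
    rw [← measure_biUnion_finset (fun i _ j _ hij => disjoint_disjointed A hij) fun j _ => hD j]
    exact measure_mono (Set.iUnion₂_mono fun j _ => disjointed_subset A j)
  calc ∑ k ∈ Finset.range n, P (A k)
      ≤ ∑ k ∈ Finset.range n, ∑ j ∈ Finset.range (k + 1), c (k - j) * P (disjointed A j) :=
        Finset.sum_le_sum fun k _ => h1 k
    _ = ∑ j ∈ Finset.range n, ∑ m ∈ Finset.range (n - j), c m * P (disjointed A j) := by
        have := Finset.sum_range_diag_flip n (fun j m => c m * P (disjointed A j))
        exact this
    _ ≤ ∑ j ∈ Finset.range n, ∑ m ∈ Finset.range n, c m * P (disjointed A j) := by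
        refine Finset.sum_le_sum fun j _ => Finset.sum_le_sum_of_subset ?_
        exact Finset.range_mono (Nat.sub_le _ _)
    _ = (∑ m ∈ Finset.range n, c m) * ∑ j ∈ Finset.range n, P (disjointed A j) := by
        rw [Finset.sum_comm, Finset.sum_mul_sum]
    _ ≤ _ := by gcongr

/-- Conditioning on `Y` by Fubini: a bound holding for each frozen value `y` survives restriction to
any event of `Y`. -/
theorem measure_preimage_inter_le_of_indepFun {Ω E F : Type*} [MeasurableSpace Ω]
    [MeasurableSpace E] [MeasurableSpace F] {P : Measure Ω} [IsProbabilityMeasure P]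
    {X : Ω → E} {Y : Ω → F} (hX : Measurable X) (hY : Measurable Y) (h : IndepFun X Y P)
    {S : Set F} (hS : MeasurableSet S) {T : Set (E × F)} (hT : MeasurableSet T) (c : ℝ≥0∞)
    (hc : ∀ y, P (X ⁻¹' {x | (x, y) ∈ T}) ≤ c) :
    P ({ω | (X ω, Y ω) ∈ T} ∩ Y ⁻¹' S) ≤ c * P (Y ⁻¹' S) := by
  have hTS : MeasurableSet (T ∩ Prod.snd ⁻¹' S) := hT.inter (measurable_snd hS)
  have e : {ω | (X ω, Y ω) ∈ T} ∩ Y ⁻¹' S = (fun ω => (X ω, Y ω)) ⁻¹' (T ∩ Prod.snd ⁻¹' S) := rfl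
  have := Measure.isProbabilityMeasure_map (μ := P) hX.aemeasurable
  have := Measure.isProbabilityMeasure_map (μ := P) hY.aemeasurable
  rw [e, ← Measure.map_apply (hX.prodMk hY) hTS,
    (indepFun_iff_map_prod_eq_prod_map_map hX.aemeasurable hY.aemeasurable).1 h,
    Measure.prod_apply_symm hTS, ← Measure.map_apply hY hS, ← setLIntegral_const,
    ← lintegral_indicator hS]
  refine lintegral_mono fun y => ?_
  by_cases hy : y ∈ S
  · rw [Set.indicator_of_mem hy]
    refine (measure_mono (Set.preimage_mono Set.inter_subset_left)).trans ?_
    rw [Measure.map_apply hX (measurable_prodMk_right hT)]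
    exact hc y
  · rw [Set.indicator_of_notMem hy]
    have : (fun x => (x, y)) ⁻¹' (T ∩ Prod.snd ⁻¹' S) = ∅ := by
      ext x; simp [hy]
    rw [this, measure_empty]

/-! ### Gaussian bounds and independence of planar increments -/

theorem gaussianReal_le_smul_volume (μ : ℝ) {v : ℝ≥0} (hv : v ≠ 0) :
    gaussianReal μ v ≤ ENNReal.ofReal (√(2 * Real.pi * v))⁻¹ • volume := by
  rw [gaussianReal_of_var_ne_zero μ hv, ← withDensity_const]
  refine withDensity_mono (ae_of_all _ fun x => ?_)
  rw [gaussianPDF_def]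
  refine ENNReal.ofReal_le_ofReal ?_
  rw [gaussianPDFReal_def]
  refine mul_le_of_le_one_right (by positivity) (Real.exp_le_one_iff.2 ?_)
  rw [neg_div]
  exact neg_nonpos.2 (by positivity)

theorem measurePreserving_prodProdProdComm {A B C D : Type*} [MeasurableSpace A]
    [MeasurableSpace B] [MeasurableSpace C] [MeasurableSpace D] (a : Measure A) (b : Measure B)
    (c : Measure C) (d : Measure D) [SFinite a] [SFinite b] [SFinite c] [SFinite d] :
    MeasurePreserving (fun p : (A × B) × (C × D) => ((p.1.1, p.2.1), (p.1.2, p.2.2)))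
      ((a.prod b).prod (c.prod d)) ((a.prod c).prod (b.prod d)) := by
  have h1 := measurePreserving_prodAssoc a b (c.prod d)
  have h2 := (MeasurePreserving.id a).prod ((measurePreserving_prodAssoc b c d).symm _)
  have h3 := (MeasurePreserving.id a).prod
    ((Measure.measurePreserving_swap (μ := b) (ν := c)).prod (MeasurePreserving.id d))
  have h4 := (MeasurePreserving.id a).prod (measurePreserving_prodAssoc c b d)
  have h5 := (measurePreserving_prodAssoc a c (b.prod d)).symm _
  exact h5.comp (h4.comp (h3.comp (h2.comp h1)))

/-- The hypotheses make all four variables jointly independent, so they may be regrouped. This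
passes from increment-versus-past independence in each coordinate to the plane. -/
theorem indepFun_prodMk_prodMk_of_indepFun {Ω A B C D : Type*} [MeasurableSpace Ω]
    [MeasurableSpace A] [MeasurableSpace B] [MeasurableSpace C] [MeasurableSpace D]
    {P : Measure Ω} [IsProbabilityMeasure P] {X : Ω → A} {Y : Ω → B} {X' : Ω → C} {Y' : Ω → D}
    (hX : Measurable X) (hY : Measurable Y) (hX' : Measurable X') (hY' : Measurable Y')
    (h : IndepFun (fun ω => (X ω, Y ω)) (fun ω => (X' ω, Y' ω)) P)
    (h1 : IndepFun X Y P) (h2 : IndepFun X' Y' P) :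
    IndepFun (fun ω => (X ω, X' ω)) (fun ω => (Y ω, Y' ω)) P := by
  have hXX' : IndepFun X X' P := h.comp measurable_fst measurable_fst
  have hYY' : IndepFun Y Y' P := h.comp measurable_snd measurable_snd
  rw [indepFun_iff_map_prod_eq_prod_map_map (by fun_prop) (by fun_prop)] at *
  have key := (measurePreserving_prodProdProdComm (P.map X) (P.map Y) (P.map X') (P.map Y')).map_eq
  rw [← h1, ← h2, ← h, Measure.map_map (by fun_prop) (by fun_prop)] at key
  rw [hXX', hYY', ← key]
  rfl

theorem measure_toLp_mem_closedBall_le {Ω : Type*} [MeasurableSpace Ω] {P : Measure Ω}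
    [IsProbabilityMeasure P] {U V : Ω → ℝ} (hU : Measurable U) (hV : Measurable V)
    (h : IndepFun U V P) {v : ℝ≥0} (hv : v ≠ 0) (hUl : P.map U = gaussianReal 0 v)
    (hVl : P.map V = gaussianReal 0 v) (x : EuclideanSpace ℝ (Fin 2)) {r : ℝ} (hr : 0 ≤ r) :
    P {ω | WithLp.toLp 2 ![U ω, V ω] ∈ Metric.closedBall x r}
      ≤ ENNReal.ofReal (r ^ 2 / (2 * v)) := by
  have hmp : MeasurePreserving
      (fun p : ℝ × ℝ => (WithLp.toLp 2 ![p.1, p.2] : EuclideanSpace ℝ (Fin 2))) :=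
    (PiLp.volume_preserving_toLp (Fin 2)).comp ((volume_preserving_finTwoArrow ℝ).symm _)
  have hS := hmp.measurable (Metric.isClosed_closedBall (x := x) (ε := r)).measurableSet
  set S := (fun p : ℝ × ℝ => (WithLp.toLp 2 ![p.1, p.2] : EuclideanSpace ℝ (Fin 2))) ⁻¹'
    Metric.closedBall x r
  have hvol : volume S = ENNReal.ofReal r ^ 2 * ENNReal.ofReal Real.pi := by
    rw [hmp.measure_preimage Metric.isClosed_closedBall.measurableSet.nullMeasurableSet,
      EuclideanSpace.volume_closedBall_fin_two]
  have hlaw := (indepFun_iff_map_prod_eq_prod_map_map hU.aemeasurable hV.aemeasurable).1 h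
  calc P {ω | WithLp.toLp 2 ![U ω, V ω] ∈ Metric.closedBall x r}
      = P.map (fun ω => (U ω, V ω)) S := (Measure.map_apply (hU.prodMk hV) hS).symm
    _ ≤ ((ENNReal.ofReal (√(2 * Real.pi * v))⁻¹ • (volume : Measure ℝ)).prod
          (ENNReal.ofReal (√(2 * Real.pi * v))⁻¹ • (volume : Measure ℝ))) S := by
        rw [hlaw, hUl, hVl]
        exact Measure.prod_mono (gaussianReal_le_smul_volume 0 hv)
          (gaussianReal_le_smul_volume 0 hv) S
    _ = ENNReal.ofReal (r ^ 2 / (2 * v)) := by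
        rw [Measure.prod_smul_left, Measure.prod_smul_right, ← Measure.volume_eq_prod,
          Measure.smul_apply, Measure.smul_apply, hvol, smul_eq_mul, smul_eq_mul,
          ← ENNReal.ofReal_pow hr, ← ENNReal.ofReal_mul (by positivity),
          ← ENNReal.ofReal_mul (by positivity), ← ENNReal.ofReal_mul (by positivity)]
        congr 1
        have hs : √(2 * Real.pi * v) ^ 2 = 2 * Real.pi * v := Real.sq_sqrt (by positivity)
        have hv' : (v : ℝ) ≠ 0 := by exact_mod_cast hv
        rw [← mul_assoc, ← mul_inv, ← pow_two, hs]
        field_simp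

/-! ### Integration over the covered point -/

theorem card_mul_volume_closedBall_le {Ω E : Type*} [MeasurableSpace Ω] {P : Measure Ω}
    [IsProbabilityMeasure P] [NormedAddCommGroup E] [NormedSpace ℝ E] [FiniteDimensional ℝ E]
    [MeasurableSpace E] [BorelSpace E] (μ : Measure E) [μ.IsAddHaarMeasure] {Z : ℕ → Ω → E}
    (hZ : ∀ k, Measurable (Z k))
    (hind : ∀ j k, j < k →
      IndepFun (fun ω => Z k ω - Z j ω) (fun ω (m : Fin (j + 1)) => Z m ω) P)
    {r : ℝ} {c : ℕ → ℝ≥0∞} (hc0 : 1 ≤ c 0)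
    (hc : ∀ j k, j < k → ∀ x, P {ω | Z k ω - Z j ω ∈ Metric.closedBall x r} ≤ c (k - j)) (n : ℕ) :
    n * μ (Metric.closedBall 0 r) ≤ (∑ m ∈ Finset.range n, c m) *
      ∫⁻ ω, μ (⋃ k ∈ Finset.range n, Metric.closedBall (Z k ω) r) ∂P := by
  have hmeas (k : ℕ) : MeasurableSet {p : E × Ω | p.1 ∈ Metric.closedBall (Z k p.2) r} := by
    simp only [Metric.mem_closedBall]
    have := hZ k
    exact measurableSet_le (by fun_prop) measurable_const
  have hslice (x : E) (k : ℕ) : MeasurableSet {ω | x ∈ Metric.closedBall (Z k ω) r} :=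
    measurable_prodMk_left (hmeas k)
  have hpt (x : E) : ∑ k ∈ Finset.range n, P {ω | x ∈ Metric.closedBall (Z k ω) r}
      ≤ (∑ m ∈ Finset.range n, c m) *
        P (⋃ k ∈ Finset.range n, {ω | x ∈ Metric.closedBall (Z k ω) r}) := by
    refine sum_measure_le_of_measure_inter_disjointed_le P _ (hslice x) c (fun j k hjk => ?_) n
    rcases hjk.eq_or_lt with rfl | hjk
    · rw [Nat.sub_self]
      exact (measure_mono Set.inter_subset_right).trans (le_mul_of_one_le_left' hc0)
    -- `S` expresses "first covered at `j`" through the past alone; `T` expresses "covered at `k`"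
    -- through the increment and the past.
    let S : Set (Fin (j + 1) → E) := {f | x ∈ Metric.closedBall (f (Fin.last j)) r ∧
      ∀ i : Fin j, x ∉ Metric.closedBall (f i.castSucc) r}
    let T : Set (E × (Fin (j + 1) → E)) :=
      {p | x ∈ Metric.closedBall (p.1 + p.2 (Fin.last j)) r}
    have hS : MeasurableSet S := by
      refine MeasurableSet.inter ?_ ?_
      · exact measurableSet_le (f := fun f : Fin (j + 1) → E => dist x (f (Fin.last j)))
          (by fun_prop) measurable_const
      · change MeasurableSet {f : Fin (j + 1) → E | ∀ i : Fin j, _}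
        rw [Set.ofPred_forall]
        refine MeasurableSet.iInter fun i => MeasurableSet.compl ?_
        exact measurableSet_le (f := fun f : Fin (j + 1) → E => dist x (f i.castSucc))
          (by fun_prop) measurable_const
    have hT : MeasurableSet T := by
      exact measurableSet_le (f := fun p : E × (Fin (j + 1) → E) => dist x (p.1 + p.2 (Fin.last j)))
        (by fun_prop) measurable_const
    have hdisj : disjointed (fun k => {ω | x ∈ Metric.closedBall (Z k ω) r}) j
        = (fun ω (m : Fin (j + 1)) => Z m ω) ⁻¹' S := by
      ext ω
      simp only [disjointed_apply, S, Set.mem_preimage, Set.mem_ofPred_eq, Fin.val_last,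
        Fin.val_castSucc, Finset.sup_set_eq_biUnion, Set.mem_sdiff, Set.mem_iUnion, Finset.mem_Iio,
        not_exists, exists_prop, not_and]
      exact and_congr_right fun _ => ⟨fun h i => h i i.2, fun h i hi => h ⟨i, hi⟩⟩
    have hAk : {ω | x ∈ Metric.closedBall (Z k ω) r}
        = {ω | (Z k ω - Z j ω, fun m : Fin (j + 1) => Z m ω) ∈ T} := by
      ext ω; simp [T]
    have := measure_preimage_inter_le_of_indepFun (X := fun ω => Z k ω - Z j ω)
      ((hZ k).sub (hZ j)) (measurable_pi_lambda _ fun m : Fin (j + 1) => hZ m) (hind j k hjk) hS hT (c (k - j)) (fun f => ?_)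
    · rw [hdisj, hAk]; exact this
    · convert hc j k hjk (x - f (Fin.last j)) using 2
      ext ω
      simp only [T, Set.mem_preimage, Set.mem_ofPred_eq, Metric.mem_closedBall, dist_eq_norm]
      rw [← norm_neg]
      congr! 2
      abel
  have hU : MeasurableSet
      {p : E × Ω | p.1 ∈ ⋃ k ∈ Finset.range n, Metric.closedBall (Z k p.2) r} := by
    have e : {p : E × Ω | p.1 ∈ ⋃ k ∈ Finset.range n, Metric.closedBall (Z k p.2) r}
        = ⋃ k ∈ Finset.range n, {p : E × Ω | p.1 ∈ Metric.closedBall (Z k p.2) r} := by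
      ext; simp
    rw [e]
    exact Finset.measurableSet_biUnion _ fun k _ => hmeas k
  have tonelli {S : Set (E × Ω)} (hS : MeasurableSet S) :
      ∫⁻ x, P {ω | (x, ω) ∈ S} ∂μ = ∫⁻ ω, μ {x | (x, ω) ∈ S} ∂P :=
    (Measure.prod_apply hS).symm.trans (Measure.prod_apply_symm hS)
  calc n * μ (Metric.closedBall 0 r)
      = ∑ k ∈ Finset.range n, ∫⁻ ω, μ (Metric.closedBall (Z k ω) r) ∂P := by
        simp [Measure.addHaar_closedBall_center]
    _ = ∑ k ∈ Finset.range n, ∫⁻ x, P {ω | x ∈ Metric.closedBall (Z k ω) r} ∂μ :=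
        Finset.sum_congr rfl fun k _ => (tonelli (hmeas k)).symm
    _ = ∫⁻ x, ∑ k ∈ Finset.range n, P {ω | x ∈ Metric.closedBall (Z k ω) r} ∂μ :=
        (lintegral_finsetSum _ fun k _ => measurable_measure_prodMk_left (hmeas k)).symm
    _ ≤ ∫⁻ x, (∑ m ∈ Finset.range n, c m) *
        P {ω | x ∈ ⋃ k ∈ Finset.range n, Metric.closedBall (Z k ω) r} ∂μ := by
        refine lintegral_mono fun x => (hpt x).trans (le_of_eq ?_)
        congr 2
        ext; simp
    _ = (∑ m ∈ Finset.range n, c m) *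
        ∫⁻ ω, μ (⋃ k ∈ Finset.range n, Metric.closedBall (Z k ω) r) ∂P := by
        have hm : Measurable fun x =>
            P {ω | x ∈ ⋃ k ∈ Finset.range n, Metric.closedBall (Z k ω) r} :=
          measurable_measure_prodMk_left hU
        rw [lintegral_const_mul _ hm]
        exact congrArg _ (tonelli hU)

/-! ### Brownian motion at integer times -/

theorem IsStandardBrownianMotion.card_mul_volume_le {Ω : Type*} [MeasurableSpace Ω]
    {P : Measure Ω} [IsProbabilityMeasure P] {ζ : ℝ≥0 → Ω → EuclideanSpace ℝ (Fin 2)}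
    (hζ : IsStandardBrownianMotion ζ P) (g : ℕ → EuclideanSpace ℝ (Fin 2)) {r : ℝ} (hr : 0 ≤ r)
    (n : ℕ) :
    n * volume (Metric.closedBall (0 : EuclideanSpace ℝ (Fin 2)) r)
      ≤ (∑ m ∈ Finset.range n, if m = 0 then 1 else ENNReal.ofReal (r ^ 2 / (2 * m))) *
        ∫⁻ ω, volume (⋃ k ∈ Finset.range n, Metric.closedBall (g k - ζ k ω) r) ∂P := by
  -- The coordinates are only known to be a.e. measurable; with countably many times, measurable
  -- versions agree with them simultaneously almost surely.
  let Y (i : Fin 2) (k : ℕ) : Ω → ℝ := ((hζ.coord i).aemeasurable k).mk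
  have hY (i : Fin 2) (k : ℕ) : Measurable (Y i k) := AEMeasurable.measurable_mk _
  have hae : ∀ᵐ ω ∂P, ∀ i, ∀ k : ℕ, ζ k ω i = Y i k ω :=
    ae_all_iff.2 fun i => ae_all_iff.2 fun k => ((hζ.coord i).aemeasurable k).ae_eq_mk
  have hI : iIndepFun (fun i ω (k : ℕ) => Y i k ω) P := by
    refine (hζ.indep.comp (fun _ f (k : ℕ) => f k) fun _ => by fun_prop).congr fun i => ?_
    filter_upwards [hae] with ω hω
    funext k
    exact hω i k
  have hinc (i : Fin 2) (j k : ℕ) (hjk : j < k) :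
      IndepFun (fun ω => Y i k ω - Y i j ω) (fun ω (m : Fin (j + 1)) => Y i m ω) P := by
    have hmem (m : Fin (j + 1)) : ((m : ℕ) : ℝ≥0) ∈ Set.Iic (j : ℝ≥0) := by
      simpa using Nat.le_of_lt_succ m.2
    have hφ : Measurable fun f : ℝ≥0 → ℝ => f ((k - j : ℕ) : ℝ≥0) := measurable_pi_apply _
    have hψ : Measurable fun (f : Set.Iic (j : ℝ≥0) → ℝ) (m : Fin (j + 1)) => f ⟨m, hmem m⟩ :=
      measurable_pi_lambda _ fun m => measurable_pi_apply _
    have h := ((hζ.coord i).indepFun_shift j).comp hφ hψ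
    refine h.congr ?_ ?_
    · filter_upwards [hae] with ω hω
      simp only [Function.comp_apply]
      rw [← Nat.cast_add, Nat.add_sub_cancel' hjk.le, hω, hω]
    · filter_upwards [hae] with ω hω
      funext m
      exact hω i m
  have hlaw (i : Fin 2) (j k : ℕ) (hjk : j < k) :
      P.map (fun ω => Y i k ω - Y i j ω) = gaussianReal 0 ((k - j : ℕ) : ℝ≥0) := by
    have h := ((hζ.coord i).hasLaw_sub k j).map_eq
    have hv : nndist (k : ℝ≥0).1 (j : ℝ≥0).1 = ((k - j : ℕ) : ℝ≥0) := by
      have : (j : ℝ) ≤ k := by exact_mod_cast hjk.le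
      refine NNReal.eq ?_
      change |((k : ℝ≥0) : ℝ) - ((j : ℝ≥0) : ℝ)| = _
      rw [NNReal.coe_natCast, NNReal.coe_natCast, NNReal.coe_natCast, Nat.cast_sub hjk.le,
        abs_of_nonneg (sub_nonneg.2 this)]
    rw [← hv, ← h]
    refine Measure.map_congr ?_
    filter_upwards [hae] with ω hω
    simp [hω]
  let Z (k : ℕ) (ω : Ω) : EuclideanSpace ℝ (Fin 2) := g k - WithLp.toLp 2 ![Y 0 k ω, Y 1 k ω]
  have hpair : Measurable
      fun p : ℝ × ℝ => (WithLp.toLp 2 ![p.1, p.2] : EuclideanSpace ℝ (Fin 2)) :=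
    (WithLp.measurable_toLp 2 _).comp ((MeasurableEquiv.finTwoArrow (α := ℝ)).symm.measurable)
  have hZ (k : ℕ) : Measurable (Z k) :=
    measurable_const.sub (hpair.comp ((hY 0 k).prodMk (hY 1 k)))
  have hsub (j k : ℕ) (ω : Ω) : Z k ω - Z j ω
      = (g k - g j) - WithLp.toLp 2 ![Y 0 k ω - Y 0 j ω, Y 1 k ω - Y 1 j ω] := by
    ext i
    fin_cases i <;> simp [Z] <;> ring
  have hind (j k : ℕ) (hjk : j < k) :
      IndepFun (fun ω => Z k ω - Z j ω) (fun ω (m : Fin (j + 1)) => Z m ω) P := by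
    have h01 := hI.indepFun (i := 0) (j := 1) (by decide)
    have hφ : Measurable fun f : ℕ → ℝ => (f k - f j, fun m : Fin (j + 1) => f m) := by fun_prop
    have h := indepFun_prodMk_prodMk_of_indepFun ((hY 0 k).sub (hY 0 j))
      (measurable_pi_lambda _ fun m : Fin (j + 1) => hY 0 m) ((hY 1 k).sub (hY 1 j))
      (measurable_pi_lambda _ fun m : Fin (j + 1) => hY 1 m)
      (h01.comp hφ hφ) (hinc 0 j k hjk) (hinc 1 j k hjk)
    have h' := h.comp (measurable_const.sub hpair : Measurable fun p => (g k - g j) - _)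
      (measurable_pi_lambda (fun (p : (Fin (j + 1) → ℝ) × (Fin (j + 1) → ℝ)) (m : Fin (j + 1)) =>
        g m - (WithLp.toLp 2 ![p.1 m, p.2 m] : EuclideanSpace ℝ (Fin 2))) fun m =>
        measurable_const.sub (hpair.comp
          (f := fun p : (Fin (j + 1) → ℝ) × (Fin (j + 1) → ℝ) => (p.1 m, p.2 m)) (by fun_prop)))
    exact h'.congr (ae_of_all _ fun ω => (hsub j k ω).symm) (ae_of_all _ fun ω => rfl)
  have hc (j k : ℕ) (hjk : j < k) (x : EuclideanSpace ℝ (Fin 2)) :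
      P {ω | Z k ω - Z j ω ∈ Metric.closedBall x r}
        ≤ if k - j = 0 then 1 else ENNReal.ofReal (r ^ 2 / (2 * (k - j : ℕ))) := by
    have hne : k - j ≠ 0 := Nat.sub_ne_zero_of_lt hjk
    rw [if_neg hne]
    have h01 := (hI.indepFun (i := 0) (j := 1) (by decide)).comp
      (φ := fun f : ℕ → ℝ => f k - f j) (ψ := fun f : ℕ → ℝ => f k - f j)
      (by fun_prop) (by fun_prop)
    rw [← NNReal.coe_natCast]
    convert measure_toLp_mem_closedBall_le ((hY 0 k).sub (hY 0 j)) ((hY 1 k).sub (hY 1 j)) h01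
      (v := ((k - j : ℕ) : ℝ≥0)) (by exact_mod_cast hne) (hlaw 0 j k hjk) (hlaw 1 j k hjk)
      ((g k - g j) - x) hr using 2
    ext ω
    simp only [Set.mem_ofPred_eq, Metric.mem_closedBall, dist_eq_norm, hsub]
    rw [← norm_neg]
    congr! 2
    simp only [Pi.sub_apply]
    abel
  refine (card_mul_volume_closedBall_le volume hZ hind
    (c := fun m => if m = 0 then 1 else ENNReal.ofReal (r ^ 2 / (2 * m))) (by simp) hc n).trans
    (le_of_eq ?_)
  congr 1
  refine lintegral_congr_ae ?_
  filter_upwards [hae] with ω hω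
  have hZω (k : ℕ) : Z k ω = g k - ζ k ω := by
    ext i
    fin_cases i <;> simp [Z, hω]
  simp only [hZω]

/-! ### Harmonic sum and asymptotics -/

theorem sum_range_succ_ofReal_div_le (r : ℝ) {t : ℝ} (ht : 1 ≤ t) :
    ∑ m ∈ Finset.range (⌊t⌋₊ + 1), (if m = 0 then 1 else ENNReal.ofReal (r ^ 2 / (2 * m)))
      ≤ ENNReal.ofReal (1 + r ^ 2 / 2 * (1 + Real.log t)) := by
  have hsum : ∑ m ∈ Finset.range ⌊t⌋₊, r ^ 2 / (2 * ((m + 1 : ℕ) : ℝ))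
      = r ^ 2 / 2 * (harmonic ⌊t⌋₊ : ℝ) := by
    rw [harmonic, Rat.cast_sum, Finset.mul_sum]
    refine Finset.sum_congr rfl fun m _ => ?_
    push_cast
    field_simp
  have hlog : 0 ≤ Real.log t := Real.log_nonneg ht
  rw [Finset.sum_range_succ', if_pos rfl, ENNReal.ofReal_add zero_le_one (by positivity),
    ENNReal.ofReal_one, add_comm]
  gcongr
  simp only [Nat.add_one_ne_zero, if_false]
  rw [← ENNReal.ofReal_sum_of_nonneg fun m _ => by positivity, hsum]
  gcongr
  exact harmonic_floor_le_one_add_log t ht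

theorem mainTheorem9 {Ω : Type*} [MeasurableSpace Ω] (P : Measure Ω) [IsProbabilityMeasure P]
    (ζ : ℝ≥0 → Ω → EuclideanSpace ℝ (Fin 2)) (hζ : IsStandardBrownianMotion ζ P)
    (r : ℝ) (hr : 0 < r) :
    ∃ ε : ℝ≥0 → ℝ, Tendsto ε atTop (𝓝 0) ∧
      ∀ g : ℝ≥0 → EuclideanSpace ℝ (Fin 2), Continuous g →
        ∀ t : ℝ≥0, 1 < t →
          ENNReal.ofReal (2 * Real.pi * (t : ℝ) / Real.log (t : ℝ) * (1 - ε t))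
            ≤ expectedSausageVolume P ζ g r t := by
  let C (t : ℝ≥0) : ℝ := 1 + r ^ 2 / 2 * (1 + Real.log t)
  -- Chosen so that `1 - ε t = (r² / 2) log t / C t`, which makes the target exactly `t * π r² / C
  -- t`.
  refine ⟨fun t => (1 + r ^ 2 / 2) / C t, ?_, fun g _ t ht => ?_⟩
  · refine Tendsto.const_div_atTop ?_ _
    have hlog : Tendsto (fun t : ℝ≥0 => Real.log t) atTop atTop :=
      Real.tendsto_log_atTop.comp (NNReal.tendsto_coe_atTop.2 tendsto_id)
    exact tendsto_atTop_add_const_left _ _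
      ((tendsto_atTop_add_const_left _ _ hlog).const_mul_atTop (by positivity))
  have ht' : 1 < (t : ℝ) := by exact_mod_cast ht
  have hlog : 0 < Real.log t := Real.log_pos ht'
  have hC : 0 < C t := by positivity
  have heq : 2 * Real.pi * (t : ℝ) / Real.log t * (1 - (1 + r ^ 2 / 2) / C t)
      = t * (r ^ 2 * Real.pi) / C t := by
    rw [one_sub_div hC.ne']
    have : C t - (1 + r ^ 2 / 2) = r ^ 2 / 2 * Real.log t := by simp only [C]; ring
    rw [this]
    field_simp
  -- Counting time `0` gives `⌊t⌋ + 1 ≥ t` balls, so rounding loses nothing.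
  have hfloor : (t : ℝ) ≤ (⌊(t : ℝ)⌋₊ + 1 : ℕ) := by
    push_cast; exact (Nat.lt_floor_add_one _).le
  have hmain := hζ.card_mul_volume_le (fun k => g k) hr.le (⌊(t : ℝ)⌋₊ + 1)
  rw [heq, ENNReal.ofReal_div_of_pos hC]
  refine ENNReal.div_le_of_le_mul' ?_
  calc ENNReal.ofReal (t * (r ^ 2 * Real.pi))
      ≤ ((⌊(t : ℝ)⌋₊ + 1 : ℕ) : ℝ≥0∞) *
          volume (Metric.closedBall (0 : EuclideanSpace ℝ (Fin 2)) r) := by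
        rw [EuclideanSpace.volume_closedBall_fin_two, ← ENNReal.ofReal_pow hr.le,
          ← ENNReal.ofReal_mul (by positivity), ENNReal.ofReal_mul t.coe_nonneg, ← ENNReal.ofReal_natCast]
        gcongr
    _ ≤ _ := hmain
    _ ≤ ENNReal.ofReal (C t) * expectedSausageVolume P ζ g r t := by
        refine mul_le_mul' (sum_range_succ_ofReal_div_le r ht'.le) (lintegral_mono fun ω => ?_)
        refine measure_mono (Set.iUnion₂_subset fun k hk => ?_)
        have hkt : (k : ℝ≥0) ≤ t := by
          have := (Nat.le_floor_iff t.2).1 (Nat.le_of_lt_succ (Finset.mem_range.1 hk))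
          exact_mod_cast this
        exact Set.subset_iUnion₂_of_subset (k : ℝ≥0) ⟨zero_le, hkt⟩ le_rfl
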